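/- Let $U\subseteq\mathbb{R}^2$ be an open set of points $(s,t)$; subscripts $s,t$ denote partial derivatives, $\times$ and $\cdot$ are the cross and dot products of $\mathbb{R}^3$, and all vector functions are real and $\mathbb{R}^3$-valued. Consider the kinematic Cosserat system $$\kappa_t=\omega_s-\omega\times\kappa,\qquad(1)$$ $$\nu_t=v_s+\kappa\times v-\omega\times\nu\qquad(2)$$ for vector functions $\omega,\kappa,\nu,v$ of $(s,t)$. For a vector function $\vec p$, with $p:=|\vec p|$, put $$\omega=\vec p_t+\frac{p-\sin p}{p^3}\bigl(\vec p\,(\vec p\cdot\vec p_t)-p^2\,\vec p_t\bigr)-\frac{1-\cos p}{p^2}\,\vec p\times\vec p_t,\qquad(3)$$ $$\kappa=\vec p_s+\frac{p-\sin p}{p^3}\bigl(\vec p\,(\vec p\cdot\vec p_s)-p^2\,\vec p_s\bigr)-\frac{1-\cos p}{p^2}\,\vec p\times\vec p_s,\qquad(4)$$ read as $\omega=\vec p_t$, $\kappa=\vec p_s$ where $\vec p=0$ (the analytic continuation), and for a vector function $\vec q$ put $$\nu=\vec q\times\kappa-\vec q_s,\qquad v=\vec q\times\omega-\vec q_t.\qquad(5)$$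 Formulas (3)–(5) with arbitrary analytic $\vec p,\vec q$ form a general analytic solution of (1)–(2), that is: (a) for any two vector functions $\vec p,\vec q$ that are analytic on $U$, the functions $\omega,\kappa,\nu,v$ given by (3)–(5) are analytic on $U$ and satisfy (1) and (2) on $U$; (b) conversely, if $\omega,\kappa,\nu,v$ are analytic on $U$ and satisfy (1) and (2) on $U$, then every point of $U$ has an open neighbourhood $V\subseteq U$ on which there are analytic vector functions $\vec p,\vec q$ such that (3), (4) and (5) hold on $V$. -/

import Mathlib

open scoped Matrix

noncomputable section

namespace CosseratRod

/-- Vectors in three-dimensional space, given by their components. -/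
abbrev Vec3 := Fin 3 → ℝ

/-- Vector functions of the two real variables `(s, t)`; `x.1` is `s` and `x.2` is `t`. -/
abbrev VecField := ℝ × ℝ → Vec3

/-- The partial derivative `f_s`. -/
def dS (f : VecField) : VecField := fun x => deriv (fun s : ℝ => f (s, x.2)) x.1

/-- The partial derivative `f_t`. -/
def dT (f : VecField) : VecField := fun x => deriv (fun t : ℝ => f (x.1, t)) x.2

/-- The Euclidean length `√(p₁² + p₂² + p₃²)`, also written `p` for a vector `p`. -/
def len (p : Vec3) : ℝ := Real.sqrt (p 0 ^ 2 + p 1 ^ 2 + p 2 ^ 2)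

/-- `w + (p - sin p) / p³ (p (p ⬝ w) - p² w) - (1 - cos p) / p² (p × w)`, where the scalar `p` is
the length of the vector `p`. At `p = 0` both correction terms vanish whatever the value of the
quotients is, so the value there is `w`, which is also the analytic continuation. -/
def darbouxForm (p w : Vec3) : Vec3 :=
  w + ((len p - Real.sin (len p)) / len p ^ 3) • ((p ⬝ᵥ w) • p - (len p ^ 2) • w)
    - ((1 - Real.cos (len p)) / len p ^ 2) • (p ⨯₃ w)

/-- The twist function `ω` generated by `p`. -/
def omegaOf (p : VecField) : VecField := fun x => darbouxForm (p x) (dT p x)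

/-- The Darboux function `κ` generated by `p`. -/
def kappaOf (p : VecField) : VecField := fun x => darbouxForm (p x) (dS p x)

/-- The linear strain `ν = q × κ - q_s`. -/
def nuOf (q κ : VecField) : VecField := fun x => q x ⨯₃ κ x - dS q x

/-- The velocity `v = q × ω - q_t`. -/
def vOf (q ω : VecField) : VecField := fun x => q x ⨯₃ ω x - dT q x

/-- First kinematic equation on `U`: `κ_t = ω_s - ω × κ`. -/
def KinematicEq1 (U : Set (ℝ × ℝ)) (ω κ : VecField) : Prop :=
  ∀ x ∈ U, dT κ x = dS ω x - ω x ⨯₃ κ x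

/-- Second kinematic equation on `U`: `ν_t = v_s + κ × v - ω × ν`. -/
def KinematicEq2 (U : Set (ℝ × ℝ)) (ω κ ν v : VecField) : Prop :=
  ∀ x ∈ U, dT ν x = dS v x + κ x ⨯₃ v x - ω x ⨯₃ ν x

/-- `(ω, κ, ν, v)` is an analytic solution on `U` of the full kinematic Cosserat system. -/
structure IsAnalyticSolution (U : Set (ℝ × ℝ)) (ω κ ν v : VecField) : Prop where
  analytic_omega : AnalyticOnNhd ℝ ω U
  analytic_kappa : AnalyticOnNhd ℝ κ U
  analytic_nu : AnalyticOnNhd ℝ ν U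
  analytic_v : AnalyticOnNhd ℝ v U
  eq1 : KinematicEq1 U ω κ
  eq2 : KinematicEq2 U ω κ ν v

end CosseratRod

end

/-! Rotations are encoded by unit quaternions. With vectors read as imaginary quaternions, `rotQ p`
is exp(-p/2), and its logarithmic derivative is -1/2 times the Darboux form (`fderiv_rotQ`). So (3)
and (4) say that Y = `rotQ p` solves Y_s = -κY/2, Y_t = -ωY/2, and (1) is the zero-curvature
condition of this system. Part (a) follows from equality of mixed partials, for Y and then for q.

Conversely, a flat analytic linear system has a local analytic solution
(`exists_analyticAt_of_flat`). Under (1) this gives Y with value 1 at the base point; its norm stays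
1, so its local logarithm is imaginary and yields p (`exists_rotation_vector`). Formula (5) is an
affine system for q. A constant extra coordinate makes it linear, and (1) and (2) make it flat
(`exists_displacement`).

The flat system is solved as an integral equation along the segments from the base point, in the
Banach algebra of curves on [0, 1]. Inverting an operator close to the identity gives existence,
uniqueness and analytic dependence on the endpoint together. -/

noncomputable section

open Filter Topology
open scoped Quaternion

/-! ### Flat analytic linear systems in a Banach algebra -/

section TotalDifferential

variable {E F : Type*} [NormedAddCommGroup E] [NormedSpace ℝ E]
  [NormedAddCommGroup F] [NormedSpace ℝ F]

/-- The map sending a vector `v` to the monomial curve `τ ↦ τ ^ n • v` on `[0, 1]`. -/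
def monomialCurve (F : Type*) [NormedAddCommGroup F] [NormedSpace ℝ F] (n : ℕ) :
    F →L[ℝ] C(unitInterval, F) :=
  LinearMap.mkContinuous
    { toFun := fun v => ⟨fun τ => (τ : ℝ) ^ n • v, by fun_prop⟩
      map_add' := fun v w => by ext τ; simp
      map_smul' := fun c v => by ext τ; exact smul_comm _ c v } 1 (fun v => by
    rw [one_mul, ContinuousMap.norm_le _ (norm_nonneg v)]
    intro τ
    have h0 : (0 : ℝ) ≤ τ := τ.2.1
    have h1 : (τ : ℝ) ^ n ≤ 1 := pow_le_one₀ h0 τ.2.2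
    simp only [LinearMap.coe_mk, AddHom.coe_mk, ContinuousMap.coe_mk, norm_smul, norm_pow,
      Real.norm_of_nonneg h0]
    exact mul_le_of_le_one_left (norm_nonneg v) h1)

@[simp]
theorem monomialCurve_apply (n : ℕ) (v : F) (τ : unitInterval) :
    monomialCurve F n v τ = (τ : ℝ) ^ n • v := rfl

theorem norm_monomialCurve_le (n : ℕ) : ‖monomialCurve F n‖ ≤ 1 :=
  LinearMap.mkContinuous_norm_le _ zero_le_one _

/-- The restrictions of an analytic map to the segments issuing from a point depend
analytically on the segment. -/
theorem AnalyticAt.exists_segment_curve [CompleteSpace F] {f : E → F} {x₀ : E}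
    (hf : AnalyticAt ℝ f x₀) :
    ∃ G : E → C(unitInterval, F), AnalyticAt ℝ G 0 ∧
      ∀ᶠ x in 𝓝 (0 : E), ∀ τ : unitInterval, G x τ = f (x₀ + (τ : ℝ) • x) := by
  obtain ⟨p, r, hp⟩ := hf
  -- By homogeneity the n-th term of the series at τx is τ^n times the term at x, so the curve τ ↦
  -- τ^n is absorbed into the n-th coefficient.
  let P : FormalMultilinearSeries ℝ E C(unitInterval, F) := fun n =>
    (monomialCurve F n).compContinuousMultilinearMap (p n)
  have hle : p.radius ≤ P.radius := by
    refine FormalMultilinearSeries.radius_le_of_le fun {n} => ?_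
    refine (ContinuousLinearMap.norm_compContinuousMultilinearMap_le _ _).trans ?_
    exact mul_le_of_le_one_left (norm_nonneg _) (norm_monomialCurve_le n)
  have hpos : 0 < P.radius := (hp.r_pos.trans_le hp.r_le).trans_le hle
  have hP := P.hasFPowerSeriesOnBall hpos
  refine ⟨P.sum, hP.analyticAt, ?_⟩
  filter_upwards [Metric.eball_mem_nhds (0 : E) hp.r_pos] with x hx τ
  have hxP : x ∈ Metric.eball (0 : E) P.radius :=
    Metric.eball_subset_eball (hp.r_le.trans hle) hx
  have h1 := (hP.hasSum hxP).mapL (ContinuousMap.evalCLM ℝ τ)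
  have hτx : (τ : ℝ) • x ∈ Metric.eball (0 : E) r := by
    rw [Metric.mem_eball, edist_zero_right] at hx ⊢
    refine lt_of_le_of_lt ?_ hx
    rw [enorm_smul]
    refine mul_le_of_le_one_left zero_le ?_
    rw [Real.enorm_of_nonneg τ.2.1]
    exact ENNReal.ofReal_le_one.2 τ.2.2
  have h2 := hp.hasSum hτx
  refine HasSum.unique ?_ h2
  convert h1 using 1
  · funext n
    simp [P, ContinuousMultilinearMap.map_smul_univ]
  · simp

/-- The antiderivative vanishing at `0`, as an operator on curves `[0, 1] → F`. -/
def curvePrimitive (F : Type*) [NormedAddCommGroup F] [NormedSpace ℝ F] :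
    C(unitInterval, F) →L[ℝ] C(unitInterval, F) :=
  LinearMap.mkContinuous
    { toFun := fun g => ⟨fun τ => ∫ σ in (0 : ℝ)..τ, Set.IccExtend zero_le_one g σ, by
        have := intervalIntegral.continuous_primitive (μ := MeasureTheory.volume)
          (f := Set.IccExtend (zero_le_one (α := ℝ)) g)
          (fun a b => (g.continuous.Icc_extend' (h := zero_le_one)).intervalIntegrable a b) 0
        fun_prop⟩
      map_add' := fun g h => by
        ext τ
        exact intervalIntegral.integral_add
          ((g.continuous.Icc_extend' (h := zero_le_one)).intervalIntegrable 0 τ)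
          ((h.continuous.Icc_extend' (h := zero_le_one)).intervalIntegrable 0 τ)
      map_smul' := fun c g => by
        ext τ
        exact intervalIntegral.integral_smul c _ } 1 (fun g => by
    rw [one_mul, ContinuousMap.norm_le _ (norm_nonneg g)]
    intro τ
    refine (intervalIntegral.norm_integral_le_of_norm_le_const (C := ‖g‖)
      fun σ _ => g.norm_coe_le_norm _).trans ?_
    rw [sub_zero, abs_of_nonneg τ.2.1]
    exact mul_le_of_le_one_right (norm_nonneg g) τ.2.2)

theorem curvePrimitive_apply (g : C(unitInterval, F)) (τ : unitInterval) :
    curvePrimitive F g τ = ∫ σ in (0 : ℝ)..τ, Set.IccExtend zero_le_one g σ := rfl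

/-- A curve vanishing at `0` is the antiderivative of its derivative. -/
theorem eq_curvePrimitive_of_hasDerivAt [CompleteSpace F] {Z : C(unitInterval, F)}
    {g : C(unitInterval, F)} (z : ℝ → F) (hz : ∀ τ : unitInterval, Z τ = z τ) (h0 : z 0 = 0)
    (hd : ∀ σ : unitInterval, HasDerivAt z (g σ) σ) : Z = curvePrimitive F g := by
  ext τ
  rw [curvePrimitive_apply, intervalIntegral.integral_eq_sub_of_hasDerivAt (f := z), h0, sub_zero,
    hz]
  · intro σ hσ
    rw [Set.uIcc_of_le τ.2.1] at hσ
    have hσ' : σ ∈ Set.Icc (0 : ℝ) 1 := ⟨hσ.1, hσ.2.trans τ.2.2⟩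
    rw [Set.IccExtend_of_mem _ _ hσ']
    exact hd ⟨σ, hσ'⟩
  · exact (g.continuous.Icc_extend' (h := zero_le_one)).intervalIntegrable 0 τ

/-- An antiderivative extends to a function that is differentiable on the whole line. -/
theorem exists_hasDerivAt_of_curvePrimitive [CompleteSpace F] (g : C(unitInterval, F)) :
    ∃ y : ℝ → F, (∀ τ : unitInterval, curvePrimitive F g τ = y τ) ∧
      ∀ σ : unitInterval, HasDerivAt y (g σ) σ := by
  refine ⟨fun t => ∫ σ in (0 : ℝ)..t, Set.IccExtend zero_le_one g σ, fun τ => rfl, fun σ => ?_⟩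
  have h := (g.continuous.Icc_extend' (h := zero_le_one)).integral_hasStrictDerivAt 0 (σ : ℝ)
  simpa using h.hasDerivAt

theorem Filter.Eventually.forall_segment {p : E → Prop} {x₀ : E} (h : ∀ᶠ x in 𝓝 x₀, p x) :
    ∀ᶠ x in 𝓝 (0 : E), ∀ τ : unitInterval, p (x₀ + (τ : ℝ) • x) := by
  obtain ⟨r, hr, hp⟩ := Metric.eventually_nhds_iff.1 h
  filter_upwards [Metric.ball_mem_nhds (0 : E) hr] with x hx τ
  refine hp ?_
  rw [mem_ball_zero_iff] at hx
  rw [dist_eq_norm, add_sub_cancel_left, norm_smul, Real.norm_of_nonneg τ.2.1]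
  exact (mul_le_of_le_one_left (norm_nonneg x) τ.2.2).trans_lt hx

/-- Evaluation of curves `[0, 1] → F` at a given time. -/
def curveEval (F : Type*) [NormedAddCommGroup F] [NormedSpace ℝ F] (τ : unitInterval) :
    C(unitInterval, F) →L[ℝ] F :=
  LinearMap.mkContinuous
    { toFun := fun g => g τ
      map_add' := fun _ _ => rfl
      map_smul' := fun _ _ => rfl } 1 fun g => by
    rw [one_mul]
    exact g.norm_coe_le_norm τ

@[simp]
theorem curveEval_apply (τ : unitInterval) (g : C(unitInterval, F)) : curveEval F τ g = g τ := rfl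

/-- The derivative of a family of segment restrictions, evaluated at a parameter. -/
theorem HasFDerivAt.segment_curve_apply {G : E → C(unitInterval, F)} {f : E → F} {x₀ x : E}
    {G' : E →L[ℝ] C(unitInterval, F)} (hG : HasFDerivAt G G' x)
    (hGf : ∀ᶠ y in 𝓝 x, ∀ τ : unitInterval, G y τ = f (x₀ + (τ : ℝ) • y)) (τ : unitInterval)
    (hf : DifferentiableAt ℝ f (x₀ + (τ : ℝ) • x)) (e : E) :
    G' e τ = (τ : ℝ) • fderiv ℝ f (x₀ + (τ : ℝ) • x) e := by
  have h1 : HasFDerivAt (fun y => G y τ) ((curveEval F τ).comp G') x :=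
    (curveEval F τ).hasFDerivAt.comp x hG
  have h2 : HasFDerivAt (fun y : E => x₀ + (τ : ℝ) • y)
      ((τ : ℝ) • ContinuousLinearMap.id ℝ E) x :=
    ((hasFDerivAt_id x).const_smul (τ : ℝ)).const_add x₀
  have h3 : HasFDerivAt (fun y => f (x₀ + (τ : ℝ) • y)) _ x := hf.hasFDerivAt.comp x h2
  have h4 := (h3.congr_of_eventuallyEq (hGf.mono fun y hy => hy τ)).unique h1
  have h5 := DFunLike.congr_fun h4 e
  simpa using h5.symm

/-- The left side is the product-rule derivative of σKy along a segment on which y' = (αK + βO)y.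
Flatness trades the derivative of K along f for that of O along e, which produces the derivative
along e of the coefficient of the integral equation. -/
theorem flat_segment_identity {M : Type*} [NormedRing M] [NormedAlgebra ℝ M] (α β σ : ℝ)
    {k o dkf doe : M} (h : dkf + k * o = doe + o * k)
    (y dke : M) :
    σ • ((α • dke + β • dkf) * y + k * ((α • k + β • o) * y)) + (1 : ℝ) • (k * y)
      = (k + σ • (α • dke + β • doe)) * y + (α • k + β • o) * (σ • (k * y)) := by
  rw [eq_sub_of_add_eq h]
  simp only [smul_add, smul_sub, add_mul, sub_mul, mul_add, smul_mul_assoc, mul_smul_comm,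
    mul_assoc, one_smul, smul_comm σ]
  abel

variable {M : Type*} [NormedRing M] [NormedAlgebra ℝ M] [CompleteSpace M]

/-- The integral equation `Y = 1 + J (L Y)` in a Banach algebra is uniquely solvable for small `L`,
and its solution depends analytically on parameters. -/
theorem AnalyticAt.exists_eq_one_add_map_mul {R : Type*} [NormedRing R] [NormedAlgebra ℝ R]
    [CompleteSpace R] {L : E → R} {x₀ : E} (hL : AnalyticAt ℝ L x₀) (h0 : L x₀ = 0)
    (J : R →L[ℝ] R) :
    ∃ Y : E → R, AnalyticAt ℝ Y x₀ ∧
      ∀ᶠ x in 𝓝 x₀, Y x = 1 + J (L x * Y x) ∧ ∀ D, D = J (L x * D) → D = 0 := by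
  -- The equation reads (1 - T x) Y = 1. Since T vanishes at x₀, 1 - T x is invertible nearby, and
  -- inversion is analytic.
  let T : E → R →L[ℝ] R := fun x => J.comp (ContinuousLinearMap.mul ℝ R (L x))
  have hT : AnalyticAt ℝ T x₀ :=
    (((ContinuousLinearMap.compL ℝ R R R J).comp
      (ContinuousLinearMap.mul ℝ R)).analyticAt _).comp hL
  have hT0 : T x₀ = 0 := by ext; simp [T, h0]
  have hunit0 : IsUnit (1 - T x₀) := by simp [hT0]
  have hunit : ∀ᶠ x in 𝓝 x₀, IsUnit (1 - T x) :=
    (analyticAt_const.sub hT).continuousAt.eventually (Units.isOpen.mem_nhds hunit0)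
  have hinv : AnalyticAt ℝ (fun x => Ring.inverse (1 - T x)) x₀ := by
    refine AnalyticAt.fun_comp ?_ (analyticAt_const.sub hT)
    obtain ⟨u, hu⟩ := hunit0
    rw [← hu]
    exact analyticAt_inverse u
  refine ⟨fun x => Ring.inverse (1 - T x) 1,
    ((ContinuousLinearMap.apply ℝ R (1 : R)).analyticAt _).comp hinv, ?_⟩
  filter_upwards [hunit] with x hx
  refine ⟨?_, fun D hD => ?_⟩
  · have h1 := DFunLike.congr_fun (Ring.mul_inverse_cancel _ hx) (1 : R)
    have h2 : Ring.inverse (1 - T x) 1 - T x (Ring.inverse (1 - T x) 1) = 1 := h1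
    exact eq_add_of_sub_eq h2
  · have h1 : (1 - T x) D = 0 := sub_eq_zero.2 hD
    have h2 := DFunLike.congr_fun (Ring.inverse_mul_cancel _ hx) D
    have h3 : Ring.inverse (1 - T x) ((1 - T x) D) = D := h2
    rw [← h3, h1, map_zero]

/-- Let `Y` solve the integral equation `Y = 1 + ∫ L Y` along the segments from `x₀`, where `L` is
the restriction of the flat connection form `a K + b O`. Then the derivative of `Y` in the
direction dual to `a` is `τ K Y`. -/
theorem fderiv_segment_solution {a b : E →L[ℝ] ℝ} {e f x₀ x : E} (hae : a e = 1) (hbe : b e = 0)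
    (hx : a x • e + b x • f = x) {K O : E → M} {GK GO Y : E → C(unitInterval, M)}
    (hGK : DifferentiableAt ℝ GK x) (hGO : DifferentiableAt ℝ GO x)
    (hGK_eq : ∀ᶠ y in 𝓝 x, ∀ τ : unitInterval, GK y τ = K (x₀ + (τ : ℝ) • y))
    (hGO_eq : ∀ᶠ y in 𝓝 x, ∀ τ : unitInterval, GO y τ = O (x₀ + (τ : ℝ) • y))
    (hK : ∀ τ : unitInterval, DifferentiableAt ℝ K (x₀ + (τ : ℝ) • x))
    (hO : ∀ τ : unitInterval, DifferentiableAt ℝ O (x₀ + (τ : ℝ) • x))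
    (hflat : ∀ τ : unitInterval,
      fderiv ℝ K (x₀ + (τ : ℝ) • x) f + K (x₀ + (τ : ℝ) • x) * O (x₀ + (τ : ℝ) • x)
        = fderiv ℝ O (x₀ + (τ : ℝ) • x) e + O (x₀ + (τ : ℝ) • x) * K (x₀ + (τ : ℝ) • x))
    (hY : DifferentiableAt ℝ Y x)
    (hY_eq : ∀ᶠ y in 𝓝 x, Y y = 1 + curvePrimitive M ((a y • GK y + b y • GO y) * Y y))
    (huniq : ∀ D, D = curvePrimitive M ((a x • GK x + b x • GO x) * D) → D = 0)
    (τ : unitInterval) :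
    fderiv ℝ Y x e τ = (τ : ℝ) • (K (x₀ + (τ : ℝ) • x) * Y x τ) := by
  obtain ⟨L, hL⟩ : ∃ L : E → C(unitInterval, M), L = fun y => a y • GK y + b y • GO y := ⟨_, rfl⟩
  have hL' := (a.hasFDerivAt.smul hGK.hasFDerivAt).add
    (b.hasFDerivAt.smul hGO.hasFDerivAt) (x := x)
  replace hL' : HasFDerivAt L _ x := hL'.congr_of_eventuallyEq (by rw [hL]; rfl)
  obtain ⟨L', hL'def⟩ : ∃ L', L' = fderiv ℝ L x e := ⟨_, rfl⟩
  have hLτ : ∀ τ, L' τ = K (x₀ + (τ : ℝ) • x) + (τ : ℝ) •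
      (a x • fderiv ℝ K (x₀ + (τ : ℝ) • x) e + b x • fderiv ℝ O (x₀ + (τ : ℝ) • x) e) := by
    intro τ
    rw [hL'def, hL'.fderiv]
    have h1 := hGK.hasFDerivAt.segment_curve_apply hGK_eq τ (hK τ) e
    have h2 := hGO.hasFDerivAt.segment_curve_apply hGO_eq τ (hO τ) e
    simp [hae, hbe, h1, h2, hGK_eq.self_of_nhds τ, smul_smul, mul_comm]
    abel
  have hLx : ∀ τ, L x τ = a x • K (x₀ + (τ : ℝ) • x) + b x • O (x₀ + (τ : ℝ) • x) := by
    intro τ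
    simp [hL, hGK_eq.self_of_nhds τ, hGO_eq.self_of_nhds τ]
  -- Differentiating the integral equation along e gives an inhomogeneous linear equation. The
  -- expected answer `Z` satisfies the same one, so their difference solves the homogeneous equation
  -- and `huniq` makes it zero.
  have hY' : fderiv ℝ Y x e = curvePrimitive M (L' * Y x + L x * fderiv ℝ Y x e) := by
    have hY_eq' : ∀ᶠ y in 𝓝 x, Y y = 1 + curvePrimitive M (L y * Y y) := by
      rw [hL]
      exact hY_eq
    have h1 : HasFDerivAt (fun y => 1 + curvePrimitive M (L y * Y y)) _ x :=
      ((curvePrimitive M).hasFDerivAt.comp x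
        (hL'.differentiableAt.hasFDerivAt.mul' hY.hasFDerivAt)).const_add 1
    have h2 := (h1.congr_of_eventuallyEq hY_eq').fderiv
    have h3 := DFunLike.congr_fun h2 e
    refine h3.trans ?_
    simp [hL'def, add_comm]
  let Z : C(unitInterval, M) := ⟨fun τ => (τ : ℝ) • (GK x τ * Y x τ), by fun_prop⟩
  have hZapp : ∀ τ, Z τ = (τ : ℝ) • (K (x₀ + (τ : ℝ) • x) * Y x τ) := fun τ => by
    simp [Z, hGK_eq.self_of_nhds τ]
  have hZ : Z = curvePrimitive M (L' * Y x + L x * Z) := by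
    obtain ⟨y, hy, hyd⟩ := exists_hasDerivAt_of_curvePrimitive (L x * Y x)
    have hYy : ∀ τ, Y x τ = 1 + y τ := fun τ => by
      rw [← hy]
      conv_lhs => rw [hY_eq.self_of_nhds]
      simp [hL]
    refine eq_curvePrimitive_of_hasDerivAt
      (fun σ => σ • (K (x₀ + σ • x) * (1 + y σ))) (fun τ => by rw [hZapp, hYy]) (by simp) ?_
    intro σ
    have h1 : HasDerivAt (fun σ : ℝ => x₀ + σ • x) x σ := by
      simpa using ((hasDerivAt_id (σ : ℝ)).smul_const x).const_add x₀
    have h2 : HasDerivAt (fun σ : ℝ => K (x₀ + σ • x)) (fderiv ℝ K (x₀ + (σ : ℝ) • x) x) σ :=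
      (hK σ).hasFDerivAt.comp_hasDerivAt (σ : ℝ) h1
    have h3 := (hasDerivAt_id (σ : ℝ)).smul (h2.mul ((hyd σ).const_add 1))
    have h4 : fderiv ℝ K (x₀ + (σ : ℝ) • x) x = a x • fderiv ℝ K (x₀ + (σ : ℝ) • x) e
        + b x • fderiv ℝ K (x₀ + (σ : ℝ) • x) f := by
      rw [← map_smul, ← map_smul, ← map_add, hx]
    refine h3.congr_deriv ?_
    rw [h4]
    have h5 := flat_segment_identity (a x) (b x) (σ : ℝ) (hflat σ) (1 + y σ)
      (fderiv ℝ K (x₀ + (σ : ℝ) • x) e)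
    rw [← hLx, ← hLτ, ← hYy, ← hZapp] at h5
    rw [ContinuousMap.add_apply, ContinuousMap.mul_apply, ContinuousMap.mul_apply,
      ContinuousMap.mul_apply, ← h5, hYy]
    rfl
  have hD := huniq (fderiv ℝ Y x e - Z) (by
    conv_lhs => rw [hY', hZ]
    rw [← map_sub, hL]
    congr 1
    rw [mul_sub]
    abel)
  rw [sub_eq_zero.1 hD, hZapp]

/-- A flat analytic total differential system `Y_s = K Y`, `Y_t = O Y` in a Banach algebra has
an analytic local solution with initial value `1`. -/
theorem exists_analyticAt_of_flat {K O : ℝ × ℝ → M} {x₀ : ℝ × ℝ} (hK : AnalyticAt ℝ K x₀)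
    (hO : AnalyticAt ℝ O x₀)
    (hflat : ∀ᶠ x in 𝓝 x₀, fderiv ℝ K x (0, 1) + K x * O x = fderiv ℝ O x (1, 0) + O x * K x) :
    ∃ Y : ℝ × ℝ → M, AnalyticAt ℝ Y x₀ ∧ Y x₀ = 1 ∧
      ∀ᶠ x in 𝓝 x₀, fderiv ℝ Y x (1, 0) = K x * Y x ∧ fderiv ℝ Y x (0, 1) = O x * Y x := by
  obtain ⟨GK, hGK, hGK_eq⟩ := hK.exists_segment_curve
  obtain ⟨GO, hGO, hGO_eq⟩ := hO.exists_segment_curve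
  let a := ContinuousLinearMap.fst ℝ ℝ ℝ
  let b := ContinuousLinearMap.snd ℝ ℝ ℝ
  have hL : AnalyticAt ℝ (fun x => a x • GK x + b x • GO x) 0 :=
    ((a.analyticAt 0).smul hGK).add ((b.analyticAt 0).smul hGO)
  obtain ⟨Y, hY, hYeq⟩ := hL.exists_eq_one_add_map_mul (by simp) (curvePrimitive M)
  have hY0 : Y 0 = 1 := by simpa using hYeq.self_of_nhds.1
  have hev : ∀ᶠ x in 𝓝 (0 : ℝ × ℝ),
      fderiv ℝ Y x (1, 0) 1 = K (x₀ + x) * Y x 1 ∧ fderiv ℝ Y x (0, 1) 1 = O (x₀ + x) * Y x 1 := by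
    filter_upwards [hYeq.eventually_nhds, hGK_eq.eventually_nhds, hGO_eq.eventually_nhds,
      hGK.eventually_analyticAt, hGO.eventually_analyticAt, hY.eventually_analyticAt,
      hK.eventually_analyticAt.forall_segment, hO.eventually_analyticAt.forall_segment,
      hflat.forall_segment] with x h1' h2 h3 h4 h5 h6 h7 h8 h9
    have h1 := h1'.mono fun y hy => hy.1
    have huniq := h1'.self_of_nhds.2
    have key1 := fderiv_segment_solution (a := a) (b := b) (e := (1, 0)) (f := (0, 1))
      (by simp [a]) (by simp [b]) (by ext <;> simp [a, b]) h4.differentiableAt h5.differentiableAt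
      h2 h3 (fun τ => (h7 τ).differentiableAt) (fun τ => (h8 τ).differentiableAt) h9
      h6.differentiableAt h1 huniq 1
    have key2 := fderiv_segment_solution (a := b) (b := a) (e := (0, 1)) (f := (1, 0))
      (by simp [b]) (by simp [a]) (by ext <;> simp [a, b]) h5.differentiableAt h4.differentiableAt
      h3 h2 (fun τ => (h8 τ).differentiableAt) (fun τ => (h7 τ).differentiableAt)
      (fun τ => (h9 τ).symm)
      h6.differentiableAt (by simpa only [add_comm (b _ • GO _)] using h1)
      (by simpa only [add_comm (b _ • GO _)] using huniq) 1
    simpa using And.intro key1 key2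
  have hsub : AnalyticAt ℝ (fun x : ℝ × ℝ => x - x₀) x₀ := analyticAt_id.sub analyticAt_const
  have htend : Tendsto (fun x : ℝ × ℝ => x - x₀) (𝓝 x₀) (𝓝 0) := by
    simpa using hsub.continuousAt.tendsto
  -- Time τ = 1 is the endpoint of the segment, where the factor τ in the derivative formula
  -- disappears.
  let ev : C(unitInterval, M) →L[ℝ] M := curveEval M 1
  have hevY : AnalyticAt ℝ (fun x => ev (Y x)) 0 := (ev.analyticAt _).comp hY
  refine ⟨fun x => ev (Y (x - x₀)), ?_, ?_, ?_⟩
  · exact AnalyticAt.fun_comp_of_eq (g := fun z => ev (Y z)) hevY hsub (sub_self x₀)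
  · simp [ev, hY0]
  · filter_upwards [htend.eventually hev, htend.eventually hY.eventually_analyticAt] with x hx hx'
    have h1 : fderiv ℝ (fun x => ev (Y (x - x₀))) x = ev.comp (fderiv ℝ Y (x - x₀)) := by
      have h2 : HasFDerivAt (fun x : ℝ × ℝ => x - x₀) (ContinuousLinearMap.id ℝ _) x :=
        (hasFDerivAt_id x).sub_const x₀
      have h3 : HasFDerivAt (fun x => ev (Y (x - x₀))) _ x :=
        ev.hasFDerivAt.comp x (hx'.differentiableAt.hasFDerivAt.comp x h2)
      rw [h3.fderiv]
      ext <;> simp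
    rw [h1]
    simpa [ev] using hx

end TotalDifferential

/-! ### Quaternions and the Darboux form -/

namespace CosseratRod

/-- The embedding of vectors as imaginary quaternions. -/
def imQ : Vec3 →L[ℝ] ℍ[ℝ] :=
  LinearMap.toContinuousLinearMap
    { toFun := fun p => ⟨0, p 0, p 1, p 2⟩
      map_add' := fun p w => by
        apply Quaternion.ext
        exacts [(add_zero _).symm, rfl, rfl, rfl]
      map_smul' := fun c p => by
        apply Quaternion.ext
        exacts [(mul_zero _).symm, rfl, rfl, rfl] }

/-- The vector of imaginary components of a quaternion. -/
def vecQ : ℍ[ℝ] →L[ℝ] Vec3 :=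
  LinearMap.toContinuousLinearMap
    { toFun := fun q => ![q.imI, q.imJ, q.imK]
      map_add' := fun p w => by ext i; fin_cases i <;> simp
      map_smul' := fun c p => by ext i; fin_cases i <;> simp }

@[simp] theorem re_imQ (p : Vec3) : (imQ p).re = 0 := rfl
@[simp] theorem imI_imQ (p : Vec3) : (imQ p).imI = p 0 := rfl
@[simp] theorem imJ_imQ (p : Vec3) : (imQ p).imJ = p 1 := rfl
@[simp] theorem imK_imQ (p : Vec3) : (imQ p).imK = p 2 := rfl

@[simp] theorem vecQ_imQ (p : Vec3) : vecQ (imQ p) = p := by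
  ext i; fin_cases i <;> rfl

theorem imQ_vecQ {q : ℍ[ℝ]} (hq : q.re = 0) : imQ (vecQ q) = q := by
  ext
  · exact hq.symm
  all_goals rfl

theorem imQ_injective : Function.Injective imQ := Function.LeftInverse.injective vecQ_imQ

theorem imQ_mul_sub (a b : Vec3) : imQ a * imQ b - imQ b * imQ a = (2 : ℝ) • imQ (a ⨯₃ b) := by
  ext <;> simp [cross_apply] <;> ring

theorem norm_imQ (p : Vec3) : ‖imQ p‖ = len p := by
  rw [← Real.sqrt_sq (norm_nonneg (imQ p)), sq, ← Quaternion.normSq_eq_norm_mul_self,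
    Quaternion.normSq_def', len]
  simp

/-- The unit quaternion of the rotation with rotation vector `-p`. -/
def rotQ (p : Vec3) : ℍ[ℝ] := NormedSpace.exp (-(1 / 2 : ℝ) • imQ p)

theorem analyticAt_rotQ (p : Vec3) : AnalyticAt ℝ rotQ p :=
  (NormedSpace.exp_analytic (𝕂 := ℝ) _).comp (((-(1 / 2 : ℝ)) • imQ).analyticAt p)

theorem rotQ_ne_zero (p : Vec3) : rotQ p ≠ 0 := by
  intro h
  have h1 := Quaternion.norm_exp (-(1 / 2 : ℝ) • imQ p)
  rw [← rotQ, h] at h1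
  simp at h1

theorem rotQ_eq (p : Vec3) :
    rotQ p = Real.cos (len p / 2) • (1 : ℍ[ℝ]) + (-(Real.sin (len p / 2) / len p)) • imQ p := by
  have hn : ‖-(1 / 2 : ℝ) • imQ p‖ = len p / 2 := by
    rw [norm_smul, norm_imQ]; norm_num; ring
  rw [rotQ, Quaternion.exp_of_re_eq_zero _ (by simp), hn, smul_smul]
  congr 1
  · ext <;> simp
  · congr 1
    field_simp

theorem hasDerivAt_len {p : Vec3} (w : Vec3) (hp : len p ≠ 0) :
    HasDerivAt (fun τ : ℝ => len (p + τ • w)) ((p ⬝ᵥ w) / len p) 0 := by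
  have h : ∀ i, HasDerivAt (fun τ : ℝ => (p + τ • w) i ^ 2) (2 * p i * w i) 0 := fun i => by
    have h1 := (((hasDerivAt_id (0 : ℝ)).mul_const (w i)).const_add (p i)).pow 2
    exact h1.congr_deriv (by simp)
  have h2 := (((h 0).add (h 1)).add (h 2)).sqrt (by
    intro h0
    apply hp
    simp at h0
    simp [len, h0])
  refine h2.congr_deriv ?_
  have : len (p + (0 : ℝ) • w) = len p := by simp
  simp [len, Matrix.vec3_dotProduct]
  ring

theorem darbouxForm_zero (w : Vec3) : darbouxForm 0 w = w := by
  simp [darbouxForm, len]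

theorem len_sq (p : Vec3) : len p ^ 2 = p 0 ^ 2 + p 1 ^ 2 + p 2 ^ 2 := Real.sq_sqrt (by positivity)

theorem len_eq_zero {p : Vec3} : len p = 0 ↔ p = 0 := by
  rw [← norm_imQ, norm_eq_zero, map_eq_zero_iff _ imQ_injective]

theorem cross_apply_zero (a b : Vec3) : (a ⨯₃ b) 0 = a 1 * b 2 - a 2 * b 1 := by
  simp [cross_apply]

theorem cross_apply_one (a b : Vec3) : (a ⨯₃ b) 1 = a 2 * b 0 - a 0 * b 2 := by
  simp [cross_apply]

theorem cross_apply_two (a b : Vec3) : (a ⨯₃ b) 2 = a 0 * b 1 - a 1 * b 0 := by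
  simp [cross_apply]

/-- The polynomial core of the logarithmic derivative. With r = |p|, it is used for s = sin(r/2)/r,
C = cos(r/2), a = (r - sin r)/r³, and m(p·w) the derivative of s along w. -/
theorem half_darboux_identity {p w : Vec3} {s C a m : ℝ}
    (ha : a * (p 0 ^ 2 + p 1 ^ 2 + p 2 ^ 2) = 1 - 2 * s * C) (hm : m = 1 / 2 * C * a - s ^ 3)
    (h1 : s ^ 2 * (p 0 ^ 2 + p 1 ^ 2 + p 2 ^ 2) + C ^ 2 = 1) :
    (-(s * (p 0 * w 0 + p 1 * w 1 + p 2 * w 2) / 2)) • (1 : ℍ[ℝ])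
        + ((-s) • imQ w + (-(m * (p 0 * w 0 + p 1 * w 1 + p 2 * w 2))) • imQ p)
      = -(1 / 2 : ℝ) • (imQ (w + a • ((p 0 * w 0 + p 1 * w 1 + p 2 * w 2) • p
          - (p 0 ^ 2 + p 1 ^ 2 + p 2 ^ 2) • w) - (2 * s ^ 2) • (p ⨯₃ w))
        * (C • (1 : ℍ[ℝ]) + (-s) • imQ p)) := by
  subst hm
  ext
  · simp [cross_apply_zero, cross_apply_one, cross_apply_two]
    ring
  · simp [cross_apply_zero, cross_apply_one, cross_apply_two]
    linear_combination -(1 / 2 * C * w 0 - 1 / 2 * s * (w 1 * p 2 - w 2 * p 1)) * ha + s * w 0 * h1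
  · simp [cross_apply_zero, cross_apply_one, cross_apply_two]
    linear_combination -(1 / 2 * C * w 1 - 1 / 2 * s * (w 2 * p 0 - w 0 * p 2)) * ha + s * w 1 * h1
  · simp [cross_apply_zero, cross_apply_one, cross_apply_two]
    linear_combination -(1 / 2 * C * w 2 - 1 / 2 * s * (w 0 * p 1 - w 1 * p 0)) * ha + s * w 2 * h1

/-- The logarithmic derivative of the rotation quaternion is half the Darboux form. -/
theorem fderiv_rotQ (p w : Vec3) :
    fderiv ℝ rotQ p w = -(1 / 2 : ℝ) • (imQ (darbouxForm p w) * rotQ p) := by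
  -- The length is not differentiable at 0, so there the derivative of the exponential at 0 is used
  -- instead.
  by_cases hp : len p = 0
  · obtain rfl := len_eq_zero.1 hp
    have h1 : HasFDerivAt rotQ ((1 : ℍ[ℝ] →L[ℝ] ℍ[ℝ]).comp (-(1 / 2 : ℝ) • imQ)) 0 :=
      HasFDerivAt.comp (g := NormedSpace.exp) (0 : Vec3)
        (by simpa using hasFDerivAt_exp_zero (𝕂 := ℝ) (𝔸 := ℍ[ℝ]))
        ((-(1 / 2 : ℝ) • imQ).hasFDerivAt)
    rw [h1.fderiv, darbouxForm_zero]
    simp [rotQ]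
  · have hl := hasDerivAt_len w hp
    have h0 : len (p + (0 : ℝ) • w) = len p := by simp
    have hline : HasDerivAt (fun τ : ℝ => p + τ • w) w 0 := by
      simpa using ((hasDerivAt_id (0 : ℝ)).smul_const w).const_add p
    have h1 : HasDerivAt (fun τ : ℝ => rotQ (p + τ • w)) (fderiv ℝ rotQ p w) 0 :=
      ((analyticAt_rotQ p).differentiableAt.hasFDerivAt).comp_hasDerivAt_of_eq 0 hline (by simp)
    have h2 := ((hl.div_const 2).cos.smul_const (1 : ℍ[ℝ])).add
      ((((hl.div_const 2).sin.div hl (by rwa [h0])).neg).smul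
        (imQ.hasFDerivAt.comp_hasDerivAt 0 hline))
    have h3 := h1.unique (h2.congr_of_eventuallyEq (Eventually.of_forall fun τ => rotQ_eq _))
    rw [h3, rotQ_eq, darbouxForm]
    have hs : Real.sin (len p) = 2 * Real.sin (len p / 2) * Real.cos (len p / 2) := by
      rw [← Real.sin_two_mul]; ring_nf
    have hc : Real.cos (len p) = 1 - 2 * Real.sin (len p / 2) ^ 2 := by
      have := Real.cos_two_mul' (len p / 2)
      have := Real.sin_sq_add_cos_sq (len p / 2)
      rw [show len p = 2 * (len p / 2) by ring, Real.cos_two_mul']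
      rw [show 2 * (len p / 2) = len p by ring]
      linarith
    have h1 := Real.sin_sq_add_cos_sq (len p / 2)
    have hr := len_sq p
    have hu : p ⬝ᵥ w = p 0 * w 0 + p 1 * w 1 + p 2 * w 2 := Matrix.vec3_dotProduct _ _
    simp only [Pi.neg_apply, Pi.div_apply, Function.comp_apply, zero_smul, add_zero]
    rw [hs, hc]
    clear h2 h3 hs hc hl
    generalize Real.sin (len p / 2) = S at *
    generalize Real.cos (len p / 2) = C at *
    generalize len p = r at *
    have key := half_darboux_identity (p := p) (w := w) (s := S / r) (C := C)
      (a := (r - 2 * S * C) / r ^ 3) (m := (C / 2 - S / r) / r ^ 2) (by rw [← hr]; field_simp)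
      (by field_simp; linear_combination 2 * S * h1) (by rw [← hr]; field_simp; exact h1)
    rw [← hr, ← hu] at key
    convert key using 2
    · congr 1
      field_simp
    · congr 2
      field_simp
    · congr 4
      field_simp
      ring

end CosseratRod

/-! ### Bilinear calculus, mixed partials and a local logarithm -/

section Calculus

variable {E F G H : Type*} [NormedAddCommGroup E] [NormedSpace ℝ E] [NormedAddCommGroup F]
  [NormedSpace ℝ F] [NormedAddCommGroup G] [NormedSpace ℝ G] [NormedAddCommGroup H]
  [NormedSpace ℝ H]

theorem AnalyticAt.clm_bilinear_comp (B : F →L[ℝ] G →L[ℝ] H) {f : E → F} {g : E → G} {x : E}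
    (hf : AnalyticAt ℝ f x) (hg : AnalyticAt ℝ g x) : AnalyticAt ℝ (fun y => B (f y) (g y)) x :=
  AnalyticAt.comp (g := fun z : F × G => B z.1 z.2) (f := fun y => (f y, g y))
    (B.analyticAt_bilinear (f x, g x)) (hf.prod hg)

theorem AnalyticAt.fderiv_apply_const [CompleteSpace F] {f : E → F} {x : E}
    (hf : AnalyticAt ℝ f x) (e : E) : AnalyticAt ℝ (fun y => fderiv ℝ f y e) x :=
  ((ContinuousLinearMap.apply ℝ F e).analyticAt _).comp hf.fderiv

theorem AnalyticAt.fderiv_fderiv_comm [CompleteSpace F] {f : E → F} {x : E}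
    (hf : AnalyticAt ℝ f x) (a b : E) :
    fderiv ℝ (fun y => fderiv ℝ f y a) x b = fderiv ℝ (fun y => fderiv ℝ f y b) x a := by
  have h (e : E) : HasFDerivAt (fun y => fderiv ℝ f y e)
      ((ContinuousLinearMap.apply ℝ F e).comp (fderiv ℝ (fderiv ℝ f) x)) x :=
    (ContinuousLinearMap.apply ℝ F e).hasFDerivAt.comp x hf.fderiv.differentiableAt.hasFDerivAt
  have hs : IsSymmSndFDerivAt ℝ f x := hf.contDiffAt.isSymmSndFDerivAt_of_omega
  rw [(h a).fderiv, (h b).fderiv]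
  exact hs b a

theorem fderiv_clm_bilinear_apply (B : F →L[ℝ] G →L[ℝ] H) {f : E → F} {g : E → G} {x : E}
    (hf : DifferentiableAt ℝ f x) (hg : DifferentiableAt ℝ g x) (e : E) :
    fderiv ℝ (fun y => B (f y) (g y)) x e = B (f x) (fderiv ℝ g x e) + B (fderiv ℝ f x e) (g x) := by
  rw [(B.hasFDerivAt_of_bilinear hf.hasFDerivAt hg.hasFDerivAt).fderiv]
  simp

theorem eventually_eq_const_of_fderiv_eq_zero {f : E → F} {x₀ : E}
    (hf : ∀ᶠ x in 𝓝 x₀, DifferentiableAt ℝ f x ∧ fderiv ℝ f x = 0) :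
    ∀ᶠ x in 𝓝 x₀, f x = f x₀ := by
  obtain ⟨r, hr, h⟩ := Metric.eventually_nhds_iff_ball.1 hf
  filter_upwards [Metric.ball_mem_nhds x₀ hr] with x hx
  exact Metric.isOpen_ball.is_const_of_fderiv_eq_zero (convex_ball x₀ r).isPreconnected
    (fun y hy => (h y hy).1.differentiableWithinAt) (fun y hy => (h y hy).2) hx
    (Metric.mem_ball_self hr)

theorem ContinuousLinearMap.prod_real_ext {L : ℝ × ℝ →L[ℝ] F} {L' : ℝ × ℝ →L[ℝ] F}
    (h1 : L (1, 0) = L' (1, 0)) (h2 : L (0, 1) = L' (0, 1)) : L = L' := by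
  ext
  · simpa using h1
  · simpa using h2

/-- The exponential of a Banach algebra has an analytic local inverse at `1`. -/
theorem exists_analyticAt_log (A : Type*) [NormedRing A] [NormedAlgebra ℝ A] [CompleteSpace A] :
    ∃ ℓ : A → A, AnalyticAt ℝ ℓ 1 ∧ ∀ᶠ y in 𝓝 (1 : A), NormedSpace.exp (ℓ y) = y := by
  have h : HasStrictFDerivAt (NormedSpace.exp : A → A)
      ((ContinuousLinearEquiv.refl ℝ A : A ≃L[ℝ] A) : A →L[ℝ] A) 0 :=
    hasStrictFDerivAt_exp_zero
  refine ⟨(h.toOpenPartialHomeomorph _).symm, ?_, ?_⟩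
  · have h1 := (h.toOpenPartialHomeomorph _).analyticAt_symm' (a := 0)
      (i := ContinuousLinearEquiv.refl ℝ A) h.mem_toOpenPartialHomeomorph_source
      (NormedSpace.exp_analytic (𝕂 := ℝ) (0 : A)) h.hasFDerivAt.fderiv
    simpa using h1
  · have h1 := h.eventually_right_inverse
    rw [NormedSpace.exp_zero] at h1
    exact h1

end Calculus

/-! ### Analyticity and the kinematic equations for given p and q -/

namespace CosseratRod

theorem dS_eq {f : VecField} {x : ℝ × ℝ} (hf : DifferentiableAt ℝ f x) :
    dS f x = fderiv ℝ f x (1, 0) := by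
  have h1 : HasDerivAt (fun s : ℝ => (s, x.2)) ((1 : ℝ), (0 : ℝ)) x.1 :=
    (hasDerivAt_id x.1).prodMk (hasDerivAt_const x.1 x.2)
  exact (hf.hasFDerivAt.comp_hasDerivAt x.1 h1).deriv

theorem dT_eq {f : VecField} {x : ℝ × ℝ} (hf : DifferentiableAt ℝ f x) :
    dT f x = fderiv ℝ f x (0, 1) := by
  have h1 : HasDerivAt (fun t : ℝ => (x.1, t)) ((0 : ℝ), (1 : ℝ)) x.2 :=
    (hasDerivAt_const x.2 x.1).prodMk (hasDerivAt_id x.2)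
  exact (hf.hasFDerivAt.comp_hasDerivAt x.2 h1).deriv

theorem eventuallyEq_dS {f : VecField} {x : ℝ × ℝ} (hf : AnalyticAt ℝ f x) :
    dS f =ᶠ[𝓝 x] fun y => fderiv ℝ f y (1, 0) :=
  hf.eventually_analyticAt.mono fun _ hy => dS_eq hy.differentiableAt

theorem eventuallyEq_dT {f : VecField} {x : ℝ × ℝ} (hf : AnalyticAt ℝ f x) :
    dT f =ᶠ[𝓝 x] fun y => fderiv ℝ f y (0, 1) :=
  hf.eventually_analyticAt.mono fun _ hy => dT_eq hy.differentiableAt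

/-- The cross product as a continuous bilinear map. -/
def crossL : Vec3 →L[ℝ] Vec3 →L[ℝ] Vec3 := (crossProduct (R := ℝ)).toContinuousBilinearMap

theorem crossL_apply (a b : Vec3) : crossL a b = a ⨯₃ b := rfl

theorem _root_.AnalyticAt.crossProduct {f g : VecField} {x : ℝ × ℝ} (hf : AnalyticAt ℝ f x)
    (hg : AnalyticAt ℝ g x) : AnalyticAt ℝ (fun y => f y ⨯₃ g y) x :=
  AnalyticAt.clm_bilinear_comp crossL hf hg

theorem rotQ_mul_rotQ_neg (p : Vec3) : rotQ p * rotQ (-p) = 1 := by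
  let +nondep : NormedAlgebra ℚ ℍ[ℝ] := .restrictScalars ℚ ℝ ℍ[ℝ]
  rw [rotQ, rotQ, map_neg, smul_neg, ← NormedSpace.exp_add_of_commute (Commute.refl _).neg_right,
    add_neg_cancel, NormedSpace.exp_zero]

/-- No division by |p| remains on the right, so analyticity across p = 0 is inherited from `rotQ`.
-/
theorem darbouxForm_eq (p w : Vec3) :
    darbouxForm p w = vecQ ((-2 : ℝ) • (fderiv ℝ rotQ p w * rotQ (-p))) := by
  rw [fderiv_rotQ, smul_mul_assoc, mul_assoc, rotQ_mul_rotQ_neg, smul_smul]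
  norm_num

theorem analyticAt_darbouxForm {p w : VecField} {x : ℝ × ℝ} (hp : AnalyticAt ℝ p x)
    (hw : AnalyticAt ℝ w x) : AnalyticAt ℝ (fun y => darbouxForm (p y) (w y)) x := by
  simp only [darbouxForm_eq]
  have h1 : AnalyticAt ℝ (fun y => fderiv ℝ rotQ (p y)) x := (analyticAt_rotQ _).fderiv.comp hp
  have h2 : AnalyticAt ℝ (fun y => fderiv ℝ rotQ (p y) (w y)) x :=
    AnalyticAt.clm_bilinear_comp (ContinuousLinearMap.id ℝ (Vec3 →L[ℝ] ℍ[ℝ])) h1 hw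
  have h3 : AnalyticAt ℝ (fun y => rotQ (-p y)) x := (analyticAt_rotQ _).comp hp.neg
  have h4 : AnalyticAt ℝ (fun y => fderiv ℝ rotQ (p y) (w y) * rotQ (-p y)) x := h2.mul h3
  exact (vecQ.analyticAt _).comp ((((-2 : ℝ) • ContinuousLinearMap.id ℝ ℍ[ℝ]).analyticAt _).comp h4)

theorem analyticAt_omegaOf {p : VecField} {x : ℝ × ℝ} (hp : AnalyticAt ℝ p x) :
    AnalyticAt ℝ (omegaOf p) x :=
  (analyticAt_darbouxForm hp (hp.fderiv_apply_const (0, 1))).congr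
    ((eventuallyEq_dT hp).mono fun y hy => by rw [omegaOf, hy])

theorem analyticAt_kappaOf {p : VecField} {x : ℝ × ℝ} (hp : AnalyticAt ℝ p x) :
    AnalyticAt ℝ (kappaOf p) x :=
  (analyticAt_darbouxForm hp (hp.fderiv_apply_const (1, 0))).congr
    ((eventuallyEq_dS hp).mono fun y hy => by rw [kappaOf, hy])

theorem analyticAt_nuOf {q κ : VecField} {x : ℝ × ℝ} (hq : AnalyticAt ℝ q x)
    (hκ : AnalyticAt ℝ κ x) : AnalyticAt ℝ (nuOf q κ) x :=
  ((hq.crossProduct hκ).sub (hq.fderiv_apply_const (1, 0))).congr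
    ((eventuallyEq_dS hq).mono fun y hy => by simp [nuOf, hy])

theorem analyticAt_vOf {q ω : VecField} {x : ℝ × ℝ} (hq : AnalyticAt ℝ q x)
    (hω : AnalyticAt ℝ ω x) : AnalyticAt ℝ (vOf q ω) x :=
  ((hq.crossProduct hω).sub (hq.fderiv_apply_const (0, 1))).congr
    ((eventuallyEq_dT hq).mono fun y hy => by simp [vOf, hy])

theorem fderiv_rotQ_comp {p : VecField} {x : ℝ × ℝ} (hp : DifferentiableAt ℝ p x) (e : ℝ × ℝ) :
    fderiv ℝ (fun y => rotQ (p y)) x e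
      = -(1 / 2 : ℝ) • (imQ (darbouxForm (p x) (fderiv ℝ p x e)) * rotQ (p x)) := by
  have h : HasFDerivAt (fun y => rotQ (p y)) _ x :=
    (analyticAt_rotQ (p x)).differentiableAt.hasFDerivAt.comp x hp.hasFDerivAt
  rw [h.fderiv, ContinuousLinearMap.comp_apply, fderiv_rotQ]

/-- The bilinear map `(a, y) ↦ -½ a y` from vectors and quaternions to quaternions. -/
def halfMul : Vec3 →L[ℝ] ℍ[ℝ] →L[ℝ] ℍ[ℝ] :=
  (ContinuousLinearMap.mul ℝ ℍ[ℝ]).comp (-(1 / 2 : ℝ) • imQ)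

theorem halfMul_apply (a : Vec3) (y : ℍ[ℝ]) : halfMul a y = -(1 / 2 : ℝ) • (imQ a * y) := by
  simp [halfMul]

theorem halfMul_left_injective {y : ℍ[ℝ]} (hy : y ≠ 0) {a b : Vec3}
    (h : halfMul a y = halfMul b y) : a = b := by
  rw [halfMul_apply, halfMul_apply] at h
  have h1 := smul_right_injective ℍ[ℝ] (r := -(1 / 2 : ℝ)) (by norm_num) h
  exact imQ_injective (mul_right_cancel₀ hy h1)

/-- The commutator of imaginary quaternions is twice the cross product; the factor -1/2 turns this
into the sign of the term -ω × κ in (1). -/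
theorem halfMul_comm_sub (a b : Vec3) (y : ℍ[ℝ]) :
    halfMul a (halfMul b y) - halfMul b (halfMul a y) = halfMul (-(a ⨯₃ b)) y := by
  have h : halfMul a (halfMul b y) - halfMul b (halfMul a y)
      = (1 / 4 : ℝ) • ((imQ a * imQ b - imQ b * imQ a) * y) := by
    simp only [halfMul_apply, mul_smul_comm, smul_smul, sub_mul, smul_sub, mul_assoc]
    norm_num
  rw [h, imQ_mul_sub, halfMul_apply, map_neg, smul_mul_assoc, smul_smul, neg_mul, smul_neg,
    neg_smul, neg_neg]
  norm_num

/-- Equate the mixed partials of Y, replace the commutator by a cross product and cancel the nonzero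
quaternion Y. -/
theorem kinematicEq1_of_halfMul {Y : ℝ × ℝ → ℍ[ℝ]} {ω κ : VecField} {x : ℝ × ℝ}
    (hY : AnalyticAt ℝ Y x) (hω : AnalyticAt ℝ ω x) (hκ : AnalyticAt ℝ κ x) (h0 : Y x ≠ 0)
    (hs : (fun y => fderiv ℝ Y y (1, 0)) =ᶠ[𝓝 x] fun y => halfMul (κ y) (Y y))
    (ht : (fun y => fderiv ℝ Y y (0, 1)) =ᶠ[𝓝 x] fun y => halfMul (ω y) (Y y)) :
    dT κ x = dS ω x - ω x ⨯₃ κ x := by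
  have h := hY.fderiv_fderiv_comm (1, 0) (0, 1)
  rw [hs.fderiv_eq, ht.fderiv_eq,
    fderiv_clm_bilinear_apply _ hκ.differentiableAt hY.differentiableAt,
    fderiv_clm_bilinear_apply _ hω.differentiableAt hY.differentiableAt, hs.eq_of_nhds,
    ht.eq_of_nhds, ← dT_eq hκ.differentiableAt, ← dS_eq hω.differentiableAt] at h
  apply halfMul_left_injective h0
  rw [sub_eq_add_neg, map_add, _root_.add_apply, ← halfMul_comm_sub,
    eq_sub_of_add_eq' h]
  abel

theorem kinematicEq1_omegaOf {p : VecField} {x : ℝ × ℝ} (hp : AnalyticAt ℝ p x) :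
    dT (kappaOf p) x = dS (omegaOf p) x - omegaOf p x ⨯₃ kappaOf p x := by
  refine kinematicEq1_of_halfMul (Y := fun y => rotQ (p y)) ((analyticAt_rotQ _).comp hp)
    (analyticAt_omegaOf hp) (analyticAt_kappaOf hp) (rotQ_ne_zero _) ?_ ?_
  · filter_upwards [hp.eventually_analyticAt] with y hy
    rw [fderiv_rotQ_comp hy.differentiableAt, halfMul_apply, kappaOf, dS_eq hy.differentiableAt]
  · filter_upwards [hp.eventually_analyticAt] with y hy
    rw [fderiv_rotQ_comp hy.differentiableAt, halfMul_apply, omegaOf, dT_eq hy.differentiableAt]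

/-- The mixed partials of q cancel; after (1) is substituted for κ_t, what remains is the Jacobi
identity for q, ω, κ. -/
theorem kinematicEq2_nuOf {q ω κ : VecField} {x : ℝ × ℝ} (hq : AnalyticAt ℝ q x)
    (hω : AnalyticAt ℝ ω x) (hκ : AnalyticAt ℝ κ x) (h1 : dT κ x = dS ω x - ω x ⨯₃ κ x) :
    dT (nuOf q κ) x = dS (vOf q ω) x + κ x ⨯₃ vOf q ω x - ω x ⨯₃ nuOf q κ x := by
  have hν : nuOf q κ =ᶠ[𝓝 x] fun y => crossL (q y) (κ y) - fderiv ℝ q y (1, 0) :=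
    (eventuallyEq_dS hq).mono fun y hy => by simp [nuOf, hy, crossL_apply]
  have hv : vOf q ω =ᶠ[𝓝 x] fun y => crossL (q y) (ω y) - fderiv ℝ q y (0, 1) :=
    (eventuallyEq_dT hq).mono fun y hy => by simp [vOf, hy, crossL_apply]
  have hqκ := (AnalyticAt.clm_bilinear_comp crossL hq hκ).differentiableAt
  have hqω := (AnalyticAt.clm_bilinear_comp crossL hq hω).differentiableAt
  have hT : dT (nuOf q κ) x = q x ⨯₃ dT κ x + dT q x ⨯₃ κ x
      - fderiv ℝ (fun y => fderiv ℝ q y (1, 0)) x (0, 1) := by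
    rw [dT_eq (analyticAt_nuOf hq hκ).differentiableAt, hν.fderiv_eq,
      fderiv_fun_sub hqκ (hq.fderiv_apply_const (1, 0)).differentiableAt,
      _root_.sub_apply,
      fderiv_clm_bilinear_apply _ hq.differentiableAt hκ.differentiableAt,
      dT_eq hq.differentiableAt, dT_eq hκ.differentiableAt]
    rfl
  have hS : dS (vOf q ω) x = q x ⨯₃ dS ω x + dS q x ⨯₃ ω x
      - fderiv ℝ (fun y => fderiv ℝ q y (1, 0)) x (0, 1) := by
    rw [dS_eq (analyticAt_vOf hq hω).differentiableAt, hv.fderiv_eq,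
      fderiv_fun_sub hqω (hq.fderiv_apply_const (0, 1)).differentiableAt,
      _root_.sub_apply,
      fderiv_clm_bilinear_apply _ hq.differentiableAt hω.differentiableAt,
      dS_eq hq.differentiableAt, dS_eq hω.differentiableAt, hq.fderiv_fderiv_comm (0, 1) (1, 0)]
    rfl
  rw [hT, hS, h1, nuOf, vOf]
  ext i
  fin_cases i <;> simp [cross_apply_zero, cross_apply_one, cross_apply_two] <;> ring

theorem isAnalyticSolution_of_analytic {U : Set (ℝ × ℝ)} {p q : VecField}
    (hp : AnalyticOnNhd ℝ p U) (hq : AnalyticOnNhd ℝ q U) :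
    IsAnalyticSolution U (omegaOf p) (kappaOf p) (nuOf q (kappaOf p)) (vOf q (omegaOf p)) where
  analytic_omega x hx := analyticAt_omegaOf (hp x hx)
  analytic_kappa x hx := analyticAt_kappaOf (hp x hx)
  analytic_nu x hx := analyticAt_nuOf (hq x hx) (analyticAt_kappaOf (hp x hx))
  analytic_v x hx := analyticAt_vOf (hq x hx) (analyticAt_omegaOf (hp x hx))
  eq1 x hx := kinematicEq1_omegaOf (hp x hx)
  eq2 x hx := kinematicEq2_nuOf (hq x hx) (analyticAt_omegaOf (hp x hx))
    (analyticAt_kappaOf (hp x hx)) (kinematicEq1_omegaOf (hp x hx))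

/-! ### Recovering p and q from a solution -/

theorem inner_halfMul_self (a : Vec3) (y : ℍ[ℝ]) : inner ℝ y (halfMul a y) = 0 := by
  rw [halfMul_apply, Quaternion.inner_def]
  simp
  ring

/-- A solution of the first kinematic equation is locally generated by a rotation vector. -/
theorem exists_rotation_vector {ω κ : VecField} {x₀ : ℝ × ℝ} (hω : AnalyticAt ℝ ω x₀)
    (hκ : AnalyticAt ℝ κ x₀) (h : ∀ᶠ x in 𝓝 x₀, dT κ x = dS ω x - ω x ⨯₃ κ x) :
    ∃ p : VecField, AnalyticAt ℝ p x₀ ∧ ∀ᶠ x in 𝓝 x₀, ω x = omegaOf p x ∧ κ x = kappaOf p x := by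
  let L : Vec3 →L[ℝ] ℍ[ℝ] := -(1 / 2 : ℝ) • imQ
  have hL (a : Vec3) (y : ℍ[ℝ]) : L a * y = halfMul a y := by simp [L, halfMul_apply]
  have hLd {f : VecField} {x : ℝ × ℝ} (hf : AnalyticAt ℝ f x) (e : ℝ × ℝ) :
      fderiv ℝ (fun y => L (f y)) x e = L (fderiv ℝ f x e) := by
    have h1 : HasFDerivAt (fun y => L (f y)) _ x :=
      L.hasFDerivAt.comp x hf.differentiableAt.hasFDerivAt
    rw [h1.fderiv, ContinuousLinearMap.comp_apply]
  obtain ⟨Y, hY, hY0, hYd⟩ := exists_analyticAt_of_flat (K := fun x => L (κ x))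
    (O := fun x => L (ω x)) ((L.analyticAt _).comp hκ) ((L.analyticAt _).comp hω) (by
      filter_upwards [h, hω.eventually_analyticAt, hκ.eventually_analyticAt] with x hx h1 h2
      rw [hLd h1, hLd h2, ← dT_eq h2.differentiableAt, ← dS_eq h1.differentiableAt, hx]
      have h3 := halfMul_comm_sub (ω x) (κ x) 1
      simp only [← hL, mul_one] at h3
      rw [sub_eq_add_neg, map_add, ← h3]
      abel)
  simp only [hL] at hYd
  have hnorm : ∀ᶠ x in 𝓝 x₀, ‖Y x‖ = 1 := by
    -- Left multiplication by an imaginary quaternion is skew-symmetric, so both partial derivatives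
    -- of |Y|² vanish.
    have h1 : ∀ᶠ x in 𝓝 x₀, ‖Y x‖ ^ 2 = ‖Y x₀‖ ^ 2 := by
      refine eventually_eq_const_of_fderiv_eq_zero (f := fun x => ‖Y x‖ ^ 2) ?_
      filter_upwards [hYd, hY.eventually_analyticAt] with x hx h1
      have h2 : HasFDerivAt (fun x => ‖Y x‖ ^ 2) _ x := h1.differentiableAt.hasFDerivAt.norm_sq
      refine ⟨h2.differentiableAt, ?_⟩
      rw [h2.fderiv]
      apply ContinuousLinearMap.prod_real_ext
      · simp [hx.1, inner_halfMul_self]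
      · simp [hx.2, inner_halfMul_self]
    filter_upwards [h1] with x hx
    rw [hY0, norm_one, one_pow] at hx
    exact (pow_eq_one_iff_of_nonneg (norm_nonneg _) two_ne_zero).1 hx
  obtain ⟨ℓ, hℓ, hexp⟩ := exists_analyticAt_log ℍ[ℝ]
  have hℓY : AnalyticAt ℝ (fun x => ℓ (Y x)) x₀ := hℓ.fun_comp_of_eq hY hY0
  let D : ℍ[ℝ] →L[ℝ] Vec3 := (-2 : ℝ) • vecQ
  have hp : AnalyticAt ℝ (fun x => D (ℓ (Y x))) x₀ := (D.analyticAt _).comp hℓY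
  have hrot : (fun x => rotQ (D (ℓ (Y x)))) =ᶠ[𝓝 x₀] Y := by
    have htend : Tendsto Y (𝓝 x₀) (𝓝 1) := hY0 ▸ hY.continuousAt.tendsto
    filter_upwards [hnorm, htend.eventually hexp] with x h1 h2
    -- The norm of exp z is exp(Re z), so |Y| = 1 forces the logarithm to be imaginary.
    have h3 : (ℓ (Y x)).re = 0 := by
      have h4 := Quaternion.norm_exp (ℓ (Y x))
      rw [h2, h1, ← Real.exp_eq_exp_ℝ, Real.norm_of_nonneg (Real.exp_pos _).le] at h4
      exact Real.exp_eq_one_iff _ |>.1 h4.symm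
    have h4 : -(1 / 2 : ℝ) • imQ (D (ℓ (Y x))) = ℓ (Y x) := by
      simp [D, imQ_vecQ h3, smul_smul]
    rw [rotQ, h4, h2]
  refine ⟨fun x => D (ℓ (Y x)), hp, ?_⟩
  filter_upwards [hrot.eventually_nhds, hYd, hnorm, hp.eventually_analyticAt] with x h1 h2 h3 h4
  have h0 : Y x ≠ 0 := norm_ne_zero_iff.1 (by rw [h3]; exact one_ne_zero)
  have h5 (e : ℝ × ℝ) : halfMul (darbouxForm (D (ℓ (Y x)))
      (fderiv ℝ (fun x => D (ℓ (Y x))) x e)) (Y x) = fderiv ℝ Y x e := by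
    have h6 := fderiv_rotQ_comp h4.differentiableAt e
    rw [Filter.EventuallyEq.fderiv_eq h1, h1.self_of_nhds] at h6
    rw [h6, halfMul_apply]
  refine ⟨halfMul_left_injective h0 ?_, halfMul_left_injective h0 ?_⟩
  · rw [omegaOf, dT_eq h4.differentiableAt, h5, h2.2]
  · rw [kappaOf, dS_eq h4.differentiableAt, h5, h2.1]

/-- The operator `(q, c) ↦ (q × κ - c ν, 0)`, as a linear function of `(κ, ν)`. -/
def strainOp : Vec3 × Vec3 →L[ℝ] (Vec3 × ℝ →L[ℝ] Vec3 × ℝ) :=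
  LinearMap.toContinuousLinearMap
    { toFun := fun k => (ContinuousLinearMap.inl ℝ Vec3 ℝ).comp
        ((crossL.flip k.1).comp (ContinuousLinearMap.fst ℝ Vec3 ℝ)
          - (ContinuousLinearMap.snd ℝ Vec3 ℝ).smulRight k.2)
      map_add' := fun k l => by
        refine ContinuousLinearMap.ext fun z => Prod.ext ?_ ?_
        · simp [smul_add]
          abel
        · simp
      map_smul' := fun c k => by
        refine ContinuousLinearMap.ext fun z => Prod.ext ?_ ?_
        · simp [smul_sub, smul_comm z.2 c]
        · simp }

theorem strainOp_apply (k : Vec3 × Vec3) (z : Vec3 × ℝ) :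
    strainOp k z = (z.1 ⨯₃ k.1 - z.2 • k.2, 0) := rfl

/-- A solution of the second kinematic equation is locally generated by a displacement vector. -/
theorem exists_displacement {ω κ ν v : VecField} {x₀ : ℝ × ℝ} (hω : AnalyticAt ℝ ω x₀)
    (hκ : AnalyticAt ℝ κ x₀) (hν : AnalyticAt ℝ ν x₀) (hv : AnalyticAt ℝ v x₀)
    (h1 : ∀ᶠ x in 𝓝 x₀, dT κ x = dS ω x - ω x ⨯₃ κ x)
    (h2 : ∀ᶠ x in 𝓝 x₀, dT ν x = dS v x + κ x ⨯₃ v x - ω x ⨯₃ ν x) :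
    ∃ q : VecField, AnalyticAt ℝ q x₀ ∧ ∀ᶠ x in 𝓝 x₀, ν x = nuOf q κ x ∧ v x = vOf q ω x := by
  have hd {f g : VecField} {x : ℝ × ℝ} (hf : AnalyticAt ℝ f x) (hg : AnalyticAt ℝ g x)
      (e : ℝ × ℝ) : fderiv ℝ (fun y => strainOp (f y, g y)) x e
        = strainOp (fderiv ℝ f x e, fderiv ℝ g x e) := by
    have h1 : HasFDerivAt (fun y => strainOp (f y, g y)) _ x :=
      strainOp.hasFDerivAt.comp x
        (hf.differentiableAt.hasFDerivAt.prodMk hg.differentiableAt.hasFDerivAt)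
    rw [h1.fderiv]
    rfl
  obtain ⟨Y, hY, hY0, hYd⟩ := exists_analyticAt_of_flat (K := fun x => strainOp (κ x, ν x))
    (O := fun x => strainOp (ω x, v x)) ((strainOp.analyticAt _).comp (hκ.prod hν))
    ((strainOp.analyticAt _).comp (hω.prod hv)) (by
      filter_upwards [h1, h2, hω.eventually_analyticAt, hκ.eventually_analyticAt,
        hν.eventually_analyticAt, hv.eventually_analyticAt] with x h1 h2 hω hκ hν hv
      rw [hd hκ hν, hd hω hv, ← dT_eq hκ.differentiableAt, ← dT_eq hν.differentiableAt,
        ← dS_eq hω.differentiableAt, ← dS_eq hv.differentiableAt, h1, h2]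
      refine ContinuousLinearMap.ext fun z => ?_
      simp only [_root_.add_apply, mul_apply_eq_comp, strainOp_apply]
      refine Prod.ext ?_ ?_
      · ext i
        fin_cases i <;> simp [cross_apply_zero, cross_apply_one, cross_apply_two] <;> ring
      · simp)
  -- The operator solution is applied to the initial vector q = 0, c = 1. The coordinate c has zero
  -- derivative, hence stays 1, and the linear system reduces to the affine system (5).
  let ev : (Vec3 × ℝ →L[ℝ] Vec3 × ℝ) →L[ℝ] Vec3 × ℝ := ContinuousLinearMap.apply ℝ _ (0, 1)
  have hz : AnalyticAt ℝ (fun x => ev (Y x)) x₀ := (ev.analyticAt _).comp hY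
  have hzd : ∀ᶠ x in 𝓝 x₀, fderiv ℝ (fun x => ev (Y x)) x (1, 0) = strainOp (κ x, ν x) (ev (Y x))
      ∧ fderiv ℝ (fun x => ev (Y x)) x (0, 1) = strainOp (ω x, v x) (ev (Y x)) := by
    filter_upwards [hYd, hY.eventually_analyticAt] with x hx hx'
    have h3 : HasFDerivAt (fun x => ev (Y x)) _ x :=
      ev.hasFDerivAt.comp x hx'.differentiableAt.hasFDerivAt
    rw [h3.fderiv, ContinuousLinearMap.comp_apply, ContinuousLinearMap.comp_apply, hx.1, hx.2]
    exact ⟨rfl, rfl⟩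
  generalize hZ : (fun x => ev (Y x)) = Z at hz hzd
  have hZ0 : Z x₀ = (0, 1) := by rw [← hZ]; simp [ev, hY0]
  replace hzd : ∀ᶠ x in 𝓝 x₀, fderiv ℝ Z x (1, 0) = strainOp (κ x, ν x) (Z x)
      ∧ fderiv ℝ Z x (0, 1) = strainOp (ω x, v x) (Z x) := by
    rw [← hZ]
    rw [← hZ] at hzd
    exact hzd
  have hfst {x : ℝ × ℝ} (hx : AnalyticAt ℝ Z x) : HasFDerivAt (fun y => (Z y).1)
      ((ContinuousLinearMap.fst ℝ Vec3 ℝ).comp (fderiv ℝ Z x)) x :=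
    hx.differentiableAt.hasFDerivAt.fst
  have hsnd {x : ℝ × ℝ} (hx : AnalyticAt ℝ Z x) : HasFDerivAt (fun y => (Z y).2)
      ((ContinuousLinearMap.snd ℝ Vec3 ℝ).comp (fderiv ℝ Z x)) x :=
    hx.differentiableAt.hasFDerivAt.snd
  have hone : ∀ᶠ x in 𝓝 x₀, (Z x).2 = 1 := by
    have h3 := eventually_eq_const_of_fderiv_eq_zero (f := fun x => (Z x).2) (x₀ := x₀) (by
      filter_upwards [hzd, hz.eventually_analyticAt] with x hx hx'
      refine ⟨(hsnd hx').differentiableAt, ?_⟩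
      rw [(hsnd hx').fderiv]
      apply ContinuousLinearMap.prod_real_ext
      · simp [hx.1, strainOp_apply]
      · simp [hx.2, strainOp_apply])
    simpa [hZ0] using h3
  refine ⟨fun x => (Z x).1, analyticAt_fst.comp hz, ?_⟩
  filter_upwards [hzd, hone, hz.eventually_analyticAt] with x hx h3 hx'
  have h4 := (hfst hx').differentiableAt
  rw [nuOf, vOf, dS_eq h4, dT_eq h4, (hfst hx').fderiv]
  simp [hx.1, hx.2, strainOp_apply, h3]

end CosseratRod
end

theorem proposition2 (U : Set (ℝ × ℝ)) (hU : IsOpen U) :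
    (∀ p q : CosseratRod.VecField, AnalyticOnNhd ℝ p U → AnalyticOnNhd ℝ q U →
      CosseratRod.IsAnalyticSolution U
        (CosseratRod.omegaOf p) (CosseratRod.kappaOf p)
        (CosseratRod.nuOf q (CosseratRod.kappaOf p))
        (CosseratRod.vOf q (CosseratRod.omegaOf p))) ∧
    (∀ ω κ ν v : CosseratRod.VecField, CosseratRod.IsAnalyticSolution U ω κ ν v →
      ∀ x ∈ U, ∃ V : Set (ℝ × ℝ), IsOpen V ∧ x ∈ V ∧ V ⊆ U ∧
        ∃ p q : CosseratRod.VecField, AnalyticOnNhd ℝ p V ∧ AnalyticOnNhd ℝ q V ∧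
          Set.EqOn ω (CosseratRod.omegaOf p) V ∧
          Set.EqOn κ (CosseratRod.kappaOf p) V ∧
          Set.EqOn ν (CosseratRod.nuOf q κ) V ∧
          Set.EqOn v (CosseratRod.vOf q ω) V) := by
  refine ⟨fun p q hp hq => CosseratRod.isAnalyticSolution_of_analytic hp hq,
    fun ω κ ν v h x hx => ?_⟩
  have hUx : Filter.Eventually (fun y => y ∈ U) (nhds x) := hU.mem_nhds hx
  have h1 := hUx.mono h.eq1
  have hω := h.analytic_omega x hx
  have hκ := h.analytic_kappa x hx
  obtain ⟨p, hp, hp'⟩ := CosseratRod.exists_rotation_vector hω hκ h1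
  obtain ⟨q, hq, hq'⟩ := CosseratRod.exists_displacement hω hκ (h.analytic_nu x hx)
    (h.analytic_v x hx) h1 (hUx.mono h.eq2)
  obtain ⟨V, hV, hVo, hxV⟩ := eventually_nhds_iff.1 (hUx.and
    (hp.eventually_analyticAt.and (hq.eventually_analyticAt.and (hp'.and hq'))))
  exact ⟨V, hVo, hxV, fun y hy => (hV y hy).1, p, q, fun y hy => (hV y hy).2.1,
    fun y hy => (hV y hy).2.2.1, fun y hy => (hV y hy).2.2.2.1.1,
    fun y hy => (hV y hy).2.2.2.1.2, fun y hy => (hV y hy).2.2.2.2.1,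
    fun y hy => (hV y hy).2.2.2.2.2⟩
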